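/- Let $\mathcal X$ be a finite set, let $1 \le n_0 \le n$ be integers, let $\sigma_\tau > 0$ and $k_\tau \in \{0,1,2,\dots\}$ for $n_0 \le \tau \le n$ be fixed in advance. A statistical query is a function $q : \mathcal X \to [0,1]$; its value on $(x_1,\dots,x_t)$ is $q(x_1,\dots,x_t) = \frac1t \sum_{i=1}^t q(x_i)$. Given $(x_1,\dots,x_t)$, the Gaussian mechanism $\mathsf M$ answers $q$ with $q(x_1,\dots,x_t) + z$, where $z \sim \mathcal N(0,\sigma_t^2)$ is fresh noise; the clipped Gaussian mechanism answers $\max(0,\min(q(x_1,\dots,x_t)+z,1))$. An analyst $\mathsf A$ is a randomized map (Markov kernel) from transcripts to statistical queries. For a dataset $\vec x \in \mathcal X^n$, the interaction $I(\vec x;\mathsf A,\mathsf M)$ starts with the empty transcript $\Pi = (\Pi_1,\dots,\Pi_n)$ and, in each round $t = n_0, n_0+1, \dots, n$ in turn, does the following $k_t$ times: draw $Q \sim \mathsf A(\Pi)$, draw the answer $R \sim \mathsf M(Q; x_1,\dots,x_t)$, and append $(Q,R)$ to $\Pi_t$. Its output is the final transcript $\Pi$. Write $(\vec x,\vec x')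 \in \mathcal N_t$ if $\vec x,\vec x' \in \mathcal X^n$ agree except possibly in the $t$-th entry. Let $\vec\rho : \{1,\dots,n\} \to [0,\infty)$, $\epsilon \ge 0$ and $\vec\delta : \{1,\dots,n\} \to [0,1]$. * The interaction with $\mathsf M$ is $\vec\rho$-zCDP if for all analysts $\mathsf A$, all $t \in \{1,\dots,n\}$ and all $(\vec x,\vec x') \in \mathcal N_t$, the law $P$ of $I(\vec x;\mathsf A,\mathsf M)$ is absolutely continuous with respect to the law $P'$ of $I(\vec x';\mathsf A,\mathsf M)$, and the privacy loss $Z = \log \frac{dP}{dP'}(Y)$, $Y \sim P$, satisfies $\mathbb E\, e^{s Z} \le e^{s(s+1)\vec\rho(t)}$ for all $s \ge 0$. * The interaction with $\mathsf M$ is $(\epsilon,\vec\delta)$-DP if for all analysts $\mathsf A$, all $t$, all $(\vec x,\vec x') \in \mathcal N_t$ and all measurable sets $E$ of transcripts, $\Pr(I(\vec x;\mathsf A,\mathsf M) \in E) \le e^{\epsilon} \Pr(I(\vec x';\mathsf A,\mathsf M) \in E) + \vec\delta(t)$. Let $$\vec\rho(t) = \sum_{\tau=n_0}^{n} \frac{k_\tau\,\mathbf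 1\{t \le \tau\}}{2\sigma_\tau^2\tau^2}, \qquad \psi(\gamma,\rho,\epsilon) = \frac{e^{(\gamma-1)(\gamma\rho-\epsilon)}}{\gamma-1}\left(1-\frac1\gamma\right)^{\gamma}.$$ Then, for $\mathsf M$ the ordinary or the clipped Gaussian mechanism: 1. The interaction with $\mathsf M$ is $\vec\rho$-zCDP. 2. Let $\epsilon > 0$, and suppose that at least one $k_\tau$ is positive. Then $\gamma \mapsto \psi(\gamma, \max_{1 \le t \le n} \vec\rho(t), \epsilon)$ has a unique minimizer $\gamma^\star$ on $(1,\infty)$, and the interaction with $\mathsf M$ is $(\epsilon,\vec\delta)$-DP with $\vec\delta(t) = \psi(\gamma^\star, \vec\rho(t), \epsilon)$; in particular these values lie in $[0,1]$. -/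

import Mathlib

open MeasureTheory ProbabilityTheory

noncomputable section

namespace GrowingADA

/-- Indices `1, …, n` of data points, equivalently of rounds: round `t` is the one in which the
dataset has size `t`. -/
abbrev Idx (n : ℕ) : Type := ↥(Finset.Icc 1 n)

/-- A growing dataset over the horizon `n`: the points `x_1, …, x_n` in order of arrival. -/
abbrev Dataset (n : ℕ) (X : Type*) : Type _ := Idx n → X

/-- The snapshot `(x_1, …, x_t)` of a growing dataset; its entry number `i : Fin t` is `x_{i+1}`. -/
def snapshot {n : ℕ} {X : Type*} (x : Dataset n X) (t : Idx n) : Fin t.1 → X :=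
  fun i => x ⟨i.1 + 1, Finset.mem_Icc.2
    ⟨Nat.succ_le_succ (Nat.zero_le _), le_trans (Nat.succ_le_of_lt i.2) (Finset.mem_Icc.1 t.2).2⟩⟩

/-- `x` and `x'` are neighbours at `t`: one is obtained from the other by replacing the `t`-th
data point. -/
def Neighbor {n : ℕ} {X : Type*} (t : Idx n) (x x' : Dataset n X) : Prop :=
  ∀ i, i ≠ t → x i = x' i

/-- Statistical queries, each given by a function from the data domain to `[0, 1]`. -/
abbrev Query (X : Type*) : Type _ := X → unitInterval

/-- The value `(∑ q(x_i)) / t` of a statistical query on a snapshot of size `t`. -/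
def Query.eval {X : Type*} (q : Query X) {t : ℕ} (s : Fin t → X) : ℝ :=
  (∑ i, (q (s i) : ℝ)) / t

/-- Finite sequences of elements of `α`, with the disjoint-union σ-algebra. -/
abbrev FinSeq (α : Type*) : Type _ := Σ m : ℕ, Fin m → α

/-- Append one element at the end of a finite sequence. -/
def FinSeq.append {α : Type*} (l : FinSeq α) (a : α) : FinSeq α := ⟨l.1 + 1, Fin.snoc l.2 a⟩

/-- Transcripts `(Π_1, …, Π_n)`, where `Π_t` is the finite sequence of (query, response) pairs of
round `t`. -/
abbrev Transcript (n : ℕ) (X : Type*) : Type _ := Idx n → FinSeq (Query X × ℝ)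

/-- The empty transcript. -/
def Transcript.empty (n : ℕ) (X : Type*) : Transcript n X := fun _ => ⟨0, Fin.elim0⟩

/-- Append a (query, response) pair to `Π_t`. -/
def Transcript.record {n : ℕ} {X : Type*} (t : Idx n) (p : Transcript n X × (Query X × ℝ)) :
    Transcript n X :=
  Function.update p.1 t ((p.1 t).append p.2)

/-- A mechanism: given a snapshot of size `t`, a randomized response to every query. -/
abbrev Mechanism (X : Type*) : Type _ := (t : ℕ) → (Fin t → X) → Kernel (Query X) ℝ

/-- An analyst chooses the next query at random, given the transcript so far. The number of
queries in each round is not chosen by the analyst during the interaction: it is the parameter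
`k` of `interact`. -/
abbrev Analyst (n : ℕ) (X : Type*) : Type _ := Kernel (Transcript n X) (Query X)

theorem measurable_eval {X : Type*} {t : ℕ} (s : Fin t → X) :
    Measurable fun q : Query X => q.eval s := by
  unfold Query.eval
  refine Measurable.div_const (Finset.measurable_sum _ fun i _ => ?_) _
  exact measurable_subtype_coe.comp (measurable_pi_apply (s i))

/-- The Gaussian mechanism: on a snapshot of size `t` it responds `q(s) + z` with
`z ∼ N(0, σ_t²)`. -/
def gaussianMechanism {X : Type*} (σ : ℕ → ℝ) : Mechanism X := fun t s =>
  { toFun := fun q => (gaussianReal 0 (Real.toNNReal (σ t ^ 2))).map fun z => q.eval s + z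
    measurable' := by
      refine Measure.measurable_of_measurable_coe _ fun B hB => ?_
      have hf : Measurable fun p : Query X × ℝ => p.1.eval s + p.2 :=
        ((measurable_eval s).comp measurable_fst).add measurable_snd
      have h := measurable_measure_prodMk_left
        (ν := gaussianReal 0 (Real.toNNReal (σ t ^ 2))) (hf hB)
      convert h using 2 with q
      exact Measure.map_apply (measurable_const_add _) hB }

/-- The map `x ↦ max(0, min(x, 1))`. -/
def clamp (x : ℝ) : ℝ := max 0 (min x 1)

theorem measurable_clamp : Measurable clamp :=
  measurable_const.max (measurable_id.min measurable_const)

/-- The clipped Gaussian mechanism: the response of the Gaussian mechanism, clamped to `[0, 1]`. -/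
def clippedGaussianMechanism {X : Type*} (σ : ℕ → ℝ) : Mechanism X := fun t s =>
  (gaussianMechanism σ t s).map clamp

theorem measurableEmbedding_sigmaMk {α : Type*} [MeasurableSpace α] (m : ℕ) :
    MeasurableEmbedding (fun v : Fin m → α => (⟨m, v⟩ : FinSeq α)) where
  injective := fun _ _ h => eq_of_heq (Sigma.mk.inj h).2
  measurable := measurable_iff_le_map.2 (iInf_le _ m)
  measurableSet_image' := by
    intro s hs
    refine MeasurableSpace.measurableSet_iInf.2 fun m' => ?_
    change MeasurableSet ((Sigma.mk m') ⁻¹' ((fun v : Fin m → α => (⟨m, v⟩ : FinSeq α)) '' s))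
    by_cases h : m' = m
    · subst h
      rwa [Set.preimage_image_eq _ sigma_mk_injective]
    · convert MeasurableSet.empty
      ext v
      simp only [Set.mem_preimage, Set.mem_image, Set.mem_empty_iff_false, iff_false]
      rintro ⟨w, _, hw⟩
      exact h (congrArg Sigma.fst hw).symm

theorem measurable_append {α : Type*} [MeasurableSpace α] :
    Measurable fun p : FinSeq α × α => p.1.append p.2 := by
  intro S hS
  have key : (fun p : FinSeq α × α => p.1.append p.2) ⁻¹' S =
      ⋃ m : ℕ, Prod.map (fun v : Fin m → α => (⟨m, v⟩ : FinSeq α)) id ''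
        ((fun p : (Fin m → α) × α => (⟨m + 1, Fin.snoc p.1 p.2⟩ : FinSeq α)) ⁻¹' S) := by
    ext ⟨⟨m, v⟩, a⟩
    simp only [Set.mem_preimage, Set.mem_iUnion, Set.mem_image, Prod.exists]
    constructor
    · intro h
      exact ⟨m, v, a, h, rfl⟩
    · rintro ⟨m', v', a', h, he⟩
      have h' : (fun p : FinSeq α × α => p.1.append p.2)
          (Prod.map (fun v : Fin m' → α => (⟨m', v⟩ : FinSeq α)) id (v', a')) ∈ S := h
      rw [he] at h'
      exact h'
  rw [key]
  refine MeasurableSet.iUnion fun m => ?_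
  refine ((measurableEmbedding_sigmaMk m).prodMap MeasurableEmbedding.id).measurableSet_image' ?_
  refine ((measurableEmbedding_sigmaMk (m + 1)).measurable.comp ?_) hS
  refine measurable_pi_lambda _ fun i => ?_
  refine Fin.lastCases ?_ (fun j => ?_) i
  · simpa using measurable_snd
  · simp only [Fin.snoc_castSucc]
    exact (measurable_pi_apply j).comp measurable_fst

theorem measurable_record {n : ℕ} {X : Type*} (t : Idx n) :
    Measurable (Transcript.record (n := n) (X := X) t) := by
  refine measurable_pi_lambda _ fun i => ?_
  by_cases h : i = t
  · subst h
    have h1 : Measurable fun p : Transcript n X × (Query X × ℝ) => p.1 i :=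
      (measurable_pi_apply i).comp measurable_fst
    simpa [Transcript.record, Function.comp_def] using
      measurable_append.comp (h1.prodMk measurable_snd)
  · simp only [Transcript.record, Function.update_of_ne h]
    exact (measurable_pi_apply i).comp measurable_fst

/-- One query in round `t`: from the transcript `Π` so far, draw `Q ∼ A(Π)`, then
`R ∼ M(Q; x_1, …, x_t)`, and append `(Q, R)` to `Π_t`. -/
def queryStep {n : ℕ} {X : Type*} (A : Analyst n X) (M : Mechanism X) (x : Dataset n X)
    (t : Idx n) : Kernel (Transcript n X) (Transcript n X) :=
  (Kernel.id ×ₖ (A ⊗ₖ (M t (snapshot x t)).prodMkLeft (Transcript n X))).map (Transcript.record t)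

/-- The rounds `n₀, …, n` in which queries are submitted. -/
def rounds (n n₀ : ℕ) : Finset (Idx n) := {τ | n₀ ≤ τ.1}

/-- The law of the transcript of the interaction on the dataset `x`: starting from the empty
transcript, the rounds `n₀, …, n` are run in increasing order, with `k t` queries in round `t`. -/
def interact {n : ℕ} {X : Type*} (n₀ : ℕ) (k : ℕ → ℕ) (A : Analyst n X) (M : Mechanism X)
    (x : Dataset n X) : Measure (Transcript n X) :=
  ((rounds n n₀).sort (· ≤ ·)).foldl
    (fun μ t => (fun ν : Measure (Transcript n X) => ν.bind (queryStep A M x t))^[k t] μ)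
    (Measure.dirac (Transcript.empty n X))

/-- The privacy loss distribution: the law under `P` of the logarithm of `dP/dQ`. -/
def privLoss {Y : Type*} [MeasurableSpace Y] (P Q : Measure Y) : Measure ℝ := P.map (llr P Q)

/-- Zero-concentrated differential privacy of a randomized map on datasets, with a privacy
parameter for each data point. The privacy loss distribution is well defined when `P ≪ Q`. -/
def IsZCDP {n : ℕ} {X Y : Type*} [MeasurableSpace Y] (F : Dataset n X → Measure Y)
    (ρ : Idx n → ℝ) : Prop :=
  (∀ i, 0 ≤ ρ i) ∧ ∀ i x x', Neighbor i x x' → F x ≪ F x' ∧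
    ∀ τ : ℝ, 0 ≤ τ → ∫⁻ z, ENNReal.ofReal (Real.exp (τ * z)) ∂(privLoss (F x) (F x')) ≤
      ENNReal.ofReal (Real.exp (τ * (τ + 1) * ρ i))

/-- Approximate differential privacy of a randomized map on datasets, with an additive parameter
for each data point. -/
def IsApproxDP {n : ℕ} {X Y : Type*} [MeasurableSpace Y] (F : Dataset n X → Measure Y)
    (ε : ℝ) (δ : Idx n → ℝ) : Prop :=
  0 ≤ ε ∧ (∀ i, δ i ∈ Set.Icc (0 : ℝ) 1) ∧ ∀ i x x', Neighbor i x x' →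
    ∀ E : Set Y, MeasurableSet E → (F x).real E ≤ Real.exp ε * (F x').real E + δ i

/-- The interaction with `M`, with `k t` queries in round `t`, is `ρ`-zCDP for all analysts. -/
def InteractionZCDP {n : ℕ} {X : Type*} (n₀ : ℕ) (k : ℕ → ℕ) (M : Mechanism X)
    (ρ : Idx n → ℝ) : Prop :=
  ∀ A : Analyst n X, IsMarkovKernel A → IsZCDP (interact n₀ k A M) ρ

/-- The interaction with `M`, with `k t` queries in round `t`, is `(ε, δ)`-DP for all analysts. -/
def InteractionDP {n : ℕ} {X : Type*} (n₀ : ℕ) (k : ℕ → ℕ) (M : Mechanism X)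
    (ε : ℝ) (δ : Idx n → ℝ) : Prop :=
  ∀ A : Analyst n X, IsMarkovKernel A → IsApproxDP (interact n₀ k A M) ε δ

/-- `ρ(t) = ∑_{τ = n₀}^{n} k_τ 1{t ≤ τ} / (2 σ_τ² τ²)`. -/
def rho (n n₀ : ℕ) (k : ℕ → ℕ) (σ : ℕ → ℝ) (t : Idx n) : ℝ :=
  ∑ τ ∈ Finset.Icc n₀ n,
    (k τ : ℝ) * (if (t : ℕ) ≤ τ then 1 else 0) / (2 * σ τ ^ 2 * (τ : ℝ) ^ 2)

/-- `ψ(γ, ρ, ε) = exp((γ - 1)(γ ρ - ε)) (1 - 1/γ)^γ / (γ - 1)`. -/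
def psi (γ ρ ε : ℝ) : ℝ :=
  Real.exp ((γ - 1) * (γ * ρ - ε)) * (1 - γ⁻¹) ^ γ / (γ - 1)

/-- `γ` minimizes `ψ(·, ρ, ε)` over `(1, ∞)`. -/
def IsOptimalOrder (ρ ε γ : ℝ) : Prop :=
  1 < γ ∧ ∀ γ' : ℝ, 1 < γ' → psi γ ρ ε ≤ psi γ' ρ ε

end GrowingADA

end

open GrowingADA

/-! Let `f` be the density of one transcript law `P` with respect to the neighbouring one `Q`. Since
`E_P f^s = E_Q f^(s+1)`, zCDP amounts to the moment bounds in `RenyiBound`. Under adaptive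
composition these multiply, so the parameters add (`RenyiBound.compProd`); under post-processing
they persist, by Hölder (`RenyiBound.map`). Choosing a query is free, because both runs use the same
analyst kernel. A Gaussian answer in round `τ` costs (difference of means)² / (2σ_τ²), and the means
differ by at most `1/τ`, or not at all if the changed point arrives after `τ`. Summing over the
queries gives `rho`. Clipping is post-processing of each answer before it is recorded, so it is free
as well.

For approximate DP, the line `x - e^ε` lies below a multiple of `x^γ`; integrating this over an
event bounds the additive error by `psi γ ρ ε` for every `γ > 1` (`RenyiBound.real_le`). For `ρ >
0`, `log ψ` is strictly convex in `γ` and its derivative runs from `-∞` to `+∞`, whence the unique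
minimizer. As `ψ → 1` when `γ → 1`, the minimum is at most 1, and monotonicity in `ρ` carries this
bound to every data point. -/

namespace GrowingADA

open scoped ENNReal

/-! ### Moments of densities under push-forward. -/

section DataProcessing

variable {Y Z : Type*} [MeasurableSpace Y] [MeasurableSpace Z]

/-- Truncating a density at a finite level, its moments increase to those of the density. -/
theorem lintegral_rpow_eq_iSup_min (μ : Measure Z) {g : Z → ℝ≥0∞} (hg : Measurable g) {a : ℝ}
    (ha : 0 < a) :
    ∫⁻ z, g z ^ a ∂μ = ⨆ N : ℕ, ∫⁻ z, (min (g z) N) ^ a ∂μ := by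
  rw [← lintegral_iSup]
  · refine lintegral_congr fun z => ?_
    have h1 : (⨆ N : ℕ, min (g z) (N : ℝ≥0∞)) = g z := by
      rw [← inf_iSup_eq, ENNReal.iSup_natCast, inf_top_eq]
    -- A positive power is an order isomorphism of `[0, ∞]`, so it commutes with suprema.
    have h2 := (ENNReal.orderIsoRpow a ha).map_iSup fun N : ℕ => min (g z) (N : ℝ≥0∞)
    rw [h1] at h2
    exact h2
  · intro N
    exact (hg.min measurable_const).pow_const a
  · intro N N' h z
    refine ENNReal.rpow_le_rpow (min_le_min le_rfl ?_) ha.le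
    exact_mod_cast h

/-- Data processing: pushing two measures forward does not increase the moments of the density
of one with respect to the other. -/
theorem lintegral_rpow_density_map_le (ν : Measure Y) [IsFiniteMeasure ν] {f : Y → ℝ≥0∞}
    (hf : Measurable f) {T : Y → Z} (hT : Measurable T) {g : Z → ℝ≥0∞} (hg : Measurable g)
    (h : (ν.withDensity f).map T = (ν.map T).withDensity g) {s : ℝ} (hs : 0 ≤ s) :
    ∫⁻ z, g z ^ (s + 1) ∂(ν.map T) ≤ ∫⁻ y, f y ^ (s + 1) ∂ν := by
  have hchange : ∀ u : Z → ℝ≥0∞, Measurable u →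
      ∫⁻ z, g z * u z ∂(ν.map T) = ∫⁻ y, f y * u (T y) ∂ν := by
    intro u hu
    have h1 : ∫⁻ z, u z ∂((ν.map T).withDensity g) = ∫⁻ z, g z * u z ∂(ν.map T) :=
      lintegral_withDensity_eq_lintegral_mul _ hg hu
    have h2 : ∫⁻ y, u (T y) ∂(ν.withDensity f) = ∫⁻ y, f y * u (T y) ∂ν :=
      lintegral_withDensity_eq_lintegral_mul _ hf (hu.comp hT)
    rw [← h1, ← h2, ← h, lintegral_map hu hT]
  rcases hs.eq_or_lt with rfl | hs
  · simpa using (hchange 1 measurable_one).le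
  have ha : 0 < s + 1 := by linarith
  -- Truncation makes the moment `J` finite, so that a power of it can be cancelled after Hölder.
  rw [lintegral_rpow_eq_iSup_min _ hg ha]
  refine iSup_le fun N => ?_
  have hm : Measurable fun z => min (g z) (N : ℝ≥0∞) := hg.min measurable_const
  set J := ∫⁻ z, (min (g z) N) ^ (s + 1) ∂(ν.map T) with hJ
  have hJtop : J ≠ ∞ := by
    refine ne_of_lt (lt_of_le_of_lt (b := ∫⁻ _, (N : ℝ≥0∞) ^ (s + 1) ∂(ν.map T)) ?_ ?_)
    · exact lintegral_mono fun z => ENNReal.rpow_le_rpow (min_le_right _ _) ha.le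
    · rw [lintegral_const]
      exact ENNReal.mul_lt_top (ENNReal.rpow_lt_top_of_nonneg ha.le (ENNReal.natCast_ne_top N))
        (measure_lt_top _ _)
  rcases eq_or_ne J 0 with hJ0 | hJ0
  · rw [hJ0]; exact zero_le
  have hconj : (s + 1).HolderConjugate ((s + 1) / s) := by
    rw [Real.holderConjugate_iff]
    refine ⟨by linarith, ?_⟩
    field_simp
    ring
  -- Give up the truncation in a single factor, pull back to `Y`, and apply Hölder with exponents `s
  -- + 1` and `(s + 1) / s`; the second norm is again a power of `J`.
  have key : J ≤ (∫⁻ y, f y ^ (s + 1) ∂ν) ^ (1 / (s + 1)) * J ^ (s / (s + 1)) := by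
    calc J ≤ ∫⁻ z, g z * (min (g z) N) ^ s ∂(ν.map T) := by
          refine lintegral_mono fun z => ?_
          change _ ^ (s + 1) ≤ _
          rw [ENNReal.rpow_add_of_nonneg _ _ hs.le zero_le_one, ENNReal.rpow_one, mul_comm]
          exact mul_le_mul_left (min_le_left _ _) _
      _ = ∫⁻ y, f y * (min (g (T y)) N) ^ s ∂ν := hchange _ (hm.pow_const s)
      _ ≤ (∫⁻ y, f y ^ (s + 1) ∂ν) ^ (1 / (s + 1)) *
          (∫⁻ y, ((min (g (T y)) N) ^ s) ^ ((s + 1) / s) ∂ν) ^ (1 / ((s + 1) / s)) :=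
          ENNReal.lintegral_mul_le_Lp_mul_Lq ν hconj hf.aemeasurable
            ((hm.comp hT).pow_const s).aemeasurable
      _ = _ := by
          have e : ∀ y, ((min (g (T y)) N) ^ s) ^ ((s + 1) / s) = (min (g (T y)) N) ^ (s + 1) := by
            intro y
            rw [← ENNReal.rpow_mul]
            congr 1
            field_simp
          simp_rw [e]
          rw [hJ, lintegral_map (hm.pow_const _) hT, one_div_div]
  have hsplit : J = J ^ (1 / (s + 1)) * J ^ (s / (s + 1)) := by
    rw [← ENNReal.rpow_add _ _ hJ0 hJtop]
    have : 1 / (s + 1) + s / (s + 1) = 1 := by field_simp; ring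
    rw [this, ENNReal.rpow_one]
  have hb0 : J ^ (s / (s + 1)) ≠ 0 := by
    simp [ENNReal.rpow_eq_zero_iff, hJ0, hJtop]
  have hbt : J ^ (s / (s + 1)) ≠ ∞ := ENNReal.rpow_ne_top_of_nonneg (by positivity) hJtop
  have := (ENNReal.mul_le_mul_iff_left hb0 hbt).1 (hsplit.symm.le.trans key)
  exact (ENNReal.rpow_le_rpow_iff (by positivity)).1 this

end DataProcessing

/-! ### Moment bounds: composition, post-processing, conversion to DP. -/

/-- The pointwise inequality behind the conversion of moment bounds on the density to
approximate differential privacy. -/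
theorem le_exp_add_mul_rpow {γ : ℝ} (hγ : 1 < γ) (ε : ℝ) {x : ℝ} (hx : 0 ≤ x) :
    x ≤ Real.exp ε + Real.exp (-((γ - 1) * ε)) * ((1 - γ⁻¹) ^ γ / (γ - 1)) * x ^ γ := by
  have hγ0 : 0 < γ - 1 := by linarith
  have hinv : 0 ≤ 1 - γ⁻¹ := by
    have := inv_le_one_of_one_le₀ hγ.le
    linarith
  obtain ⟨y, hy, rfl⟩ : ∃ y, 0 ≤ y ∧ x = Real.exp ε * y :=
    ⟨Real.exp (-ε) * x, by positivity, by rw [← mul_assoc, ← Real.exp_add]; simp⟩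
  -- Bernoulli expanded at `y = γ / (γ - 1)`, where the line `y - 1` is tangent to the multiple of
  -- `y ^ γ`; this produces the factor `(1 - 1/γ)^γ / (γ - 1)`.
  have hbern := one_add_mul_self_le_rpow_one_add (s := (1 - γ⁻¹) * y - 1) (p := γ)
    (by linarith [mul_nonneg hinv hy]) hγ.le
  rw [add_sub_cancel, Real.mul_rpow hinv hy] at hbern
  have e1 : 1 + γ * ((1 - γ⁻¹) * y - 1) = (γ - 1) * (y - 1) := by
    field_simp
    ring
  rw [e1] at hbern
  have hy1 : y ≤ 1 + (1 - γ⁻¹) ^ γ / (γ - 1) * y ^ γ := by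
    have : y - 1 ≤ (1 - γ⁻¹) ^ γ * y ^ γ / (γ - 1) := by
      rw [le_div_iff₀ hγ0]; linarith
    rw [div_mul_eq_mul_div]; linarith
  have e2 : Real.exp (-((γ - 1) * ε)) * (Real.exp ε) ^ γ = Real.exp ε := by
    rw [← Real.exp_mul, ← Real.exp_add]; congr 1; ring
  calc Real.exp ε * y ≤ Real.exp ε * (1 + (1 - γ⁻¹) ^ γ / (γ - 1) * y ^ γ) := by gcongr
    _ = Real.exp ε + (Real.exp (-((γ - 1) * ε)) * (Real.exp ε) ^ γ) *
        ((1 - γ⁻¹) ^ γ / (γ - 1) * y ^ γ) := by rw [e2]; ring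
    _ = _ := by rw [Real.mul_rpow (Real.exp_nonneg _) hy]; ring

/-- `P` has a density with respect to `Q` whose moments are those allowed by `ρ`-zCDP. -/
def RenyiBound {Y : Type*} [MeasurableSpace Y] (P Q : Measure Y) (ρ : ℝ) : Prop :=
  ∃ f : Y → ℝ≥0∞, Measurable f ∧ P = Q.withDensity f ∧
    ∀ s : ℝ, 0 ≤ s → ∫⁻ y, f y ^ (s + 1) ∂Q ≤ ENNReal.ofReal (Real.exp (s * (s + 1) * ρ))

namespace RenyiBound

variable {Y Z : Type*} [MeasurableSpace Y] [MeasurableSpace Z] {P Q : Measure Y} {ρ ρ' : ℝ}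

theorem refl (P : Measure Y) [IsProbabilityMeasure P] : RenyiBound P P 0 :=
  ⟨1, measurable_one, by simp, fun s _ => by simp⟩

theorem absolutelyContinuous (h : RenyiBound P Q ρ) : P ≪ Q := by
  obtain ⟨f, _, rfl, _⟩ := h
  exact withDensity_absolutelyContinuous _ _

theorem map [IsProbabilityMeasure P] [IsProbabilityMeasure Q] (h : RenyiBound P Q ρ) {T : Y → Z}
    (hT : Measurable T) : RenyiBound (P.map T) (Q.map T) ρ := by
  have hac := h.absolutelyContinuous.map hT
  obtain ⟨f, hf, hPQ, hb⟩ := h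
  have : IsProbabilityMeasure (P.map T) := Measure.isProbabilityMeasure_map hT.aemeasurable
  have : IsProbabilityMeasure (Q.map T) := Measure.isProbabilityMeasure_map hT.aemeasurable
  have hd := Measure.withDensity_rnDeriv_eq (P.map T) (Q.map T) hac
  refine ⟨_, Measure.measurable_rnDeriv (P.map T) (Q.map T), hd.symm, fun s hs => ?_⟩
  refine (lintegral_rpow_density_map_le Q hf hT (Measure.measurable_rnDeriv _ _) ?_ hs).trans
    (hb s hs)
  rw [hd, hPQ]

/-- Adaptive composition. -/
theorem compProd [IsProbabilityMeasure P] [IsProbabilityMeasure Q] (h : RenyiBound P Q ρ)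
    {κ η : Kernel Y Z} [IsMarkovKernel κ] [IsMarkovKernel η] {g : Y × Z → ℝ≥0∞}
    (hg : Measurable g) (hκ : ∀ y, κ y = (η y).withDensity fun z => g (y, z))
    (hb : ∀ y s, 0 ≤ s →
      ∫⁻ z, g (y, z) ^ (s + 1) ∂(η y) ≤ ENNReal.ofReal (Real.exp (s * (s + 1) * ρ'))) :
    RenyiBound (P ⊗ₘ κ) (Q ⊗ₘ η) (ρ + ρ') := by
  obtain ⟨f, hf, hPQ, hfb⟩ := h
  have hfg : Measurable fun p : Y × Z => f p.1 * g p := (hf.comp measurable_fst).mul hg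
  refine ⟨fun p => f p.1 * g p, hfg, ?_, fun s hs => ?_⟩
  · refine Measure.ext_of_lintegral _ fun u hu => ?_
    rw [Measure.lintegral_compProd hu, lintegral_withDensity_eq_lintegral_mul _ hfg hu,
      Measure.lintegral_compProd (hfg.mul hu)]
    have hin : ∀ y, ∫⁻ z, u (y, z) ∂(κ y) = ∫⁻ z, g (y, z) * u (y, z) ∂(η y) := by
      intro y
      rw [hκ y]
      exact lintegral_withDensity_eq_lintegral_mul _ (hg.comp measurable_prodMk_left)
        (hu.comp measurable_prodMk_left)
    simp_rw [hin]
    have hmeas : Measurable fun y => ∫⁻ z, g (y, z) * u (y, z) ∂(η y) :=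
      (hg.mul hu).lintegral_kernel_prod_right'
    rw [hPQ, lintegral_withDensity_eq_lintegral_mul _ hf hmeas]
    refine lintegral_congr fun y => ?_
    simp only [Pi.mul_apply, mul_assoc]
    rw [lintegral_const_mul]
    exact (hg.comp measurable_prodMk_left).mul (hu.comp measurable_prodMk_left)
  · have ha : 0 ≤ s + 1 := by linarith
    rw [Measure.lintegral_compProd (hfg.pow_const _)]
    calc ∫⁻ y, ∫⁻ z, (f y * g (y, z)) ^ (s + 1) ∂(η y) ∂Q
        = ∫⁻ y, f y ^ (s + 1) * ∫⁻ z, g (y, z) ^ (s + 1) ∂(η y) ∂Q := by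
          refine lintegral_congr fun y => ?_
          simp_rw [ENNReal.mul_rpow_of_nonneg _ _ ha]
          rw [lintegral_const_mul]
          exact (hg.comp measurable_prodMk_left).pow_const _
      _ ≤ ∫⁻ y, f y ^ (s + 1) * ENNReal.ofReal (Real.exp (s * (s + 1) * ρ')) ∂Q :=
          lintegral_mono fun y => mul_le_mul_right (hb y s hs) _
      _ = (∫⁻ y, f y ^ (s + 1) ∂Q) * ENNReal.ofReal (Real.exp (s * (s + 1) * ρ')) :=
          lintegral_mul_const _ (hf.pow_const _)
      _ ≤ ENNReal.ofReal (Real.exp (s * (s + 1) * ρ)) *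
          ENNReal.ofReal (Real.exp (s * (s + 1) * ρ')) := mul_le_mul_left (hfb s hs) _
      _ = _ := by
          rw [← ENNReal.ofReal_mul (Real.exp_nonneg _), ← Real.exp_add]
          congr 2
          ring

/-- The moment generating function of the privacy loss. -/
theorem lintegral_privLoss_le [IsProbabilityMeasure P] [IsProbabilityMeasure Q]
    (h : RenyiBound P Q ρ) {s : ℝ} (hs : 0 ≤ s) :
    ∫⁻ z, ENNReal.ofReal (Real.exp (s * z)) ∂(privLoss P Q) ≤
      ENNReal.ofReal (Real.exp (s * (s + 1) * ρ)) := by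
  obtain ⟨f, hf, hPQ, hb⟩ := h
  have hmeas : Measurable fun z : ℝ => ENNReal.ofReal (Real.exp (s * z)) := by fun_prop
  have hr : P.rnDeriv Q =ᵐ[Q] f := by
    rw [hPQ]; exact Measure.rnDeriv_withDensity Q hf
  rw [privLoss, lintegral_map hmeas (measurable_llr P Q)]
  refine le_trans (le_of_eq ?_) (hb s hs)
  have e : ∫⁻ y, ENNReal.ofReal (Real.exp (s * llr P Q y)) ∂P =
      ∫⁻ y, ENNReal.ofReal (Real.exp (s * llr P Q y)) ∂(Q.withDensity f) :=
    congrArg (fun μ => ∫⁻ y, ENNReal.ofReal (Real.exp (s * llr P Q y)) ∂μ) hPQ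
  refine (e.trans (lintegral_withDensity_eq_lintegral_mul _ hf
    (hmeas.comp (measurable_llr P Q)))).trans ?_
  refine lintegral_congr_ae ?_
  filter_upwards [hr, Measure.rnDeriv_lt_top P Q] with y hy hlt
  rw [hy] at hlt
  simp only [Pi.mul_apply, llr, hy]
  -- Where `f` vanishes the log-likelihood ratio has the default value `log 0 = 0`, but the factor
  -- `f` from the change of measure removes these points.
  rcases eq_or_ne (f y) 0 with h0 | h0
  · rw [h0, zero_mul, ENNReal.zero_rpow_of_pos (by linarith)]
  · have hpos : 0 < (f y).toReal := ENNReal.toReal_pos h0 hlt.ne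
    rw [mul_comm s, ← Real.rpow_def_of_pos hpos, ← ENNReal.ofReal_rpow_of_pos hpos,
      ENNReal.ofReal_toReal hlt.ne, ENNReal.rpow_add _ _ h0 hlt.ne, ENNReal.rpow_one, mul_comm]

/-- Conversion to approximate differential privacy. -/
theorem real_le [IsProbabilityMeasure P] [IsProbabilityMeasure Q] (h : RenyiBound P Q ρ)
    (ε : ℝ) {γ : ℝ} (hγ : 1 < γ) {E : Set Y} (hE : MeasurableSet E) :
    P.real E ≤ Real.exp ε * Q.real E + psi γ ρ ε := by
  have hγ0 : 0 < γ - 1 := by linarith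
  have hinv : 0 ≤ 1 - γ⁻¹ := by
    have := inv_le_one_of_one_le₀ hγ.le
    linarith
  obtain ⟨f, hf, hPQ, hb⟩ := h
  set C : ℝ := Real.exp (-((γ - 1) * ε)) * ((1 - γ⁻¹) ^ γ / (γ - 1)) with hC
  have hC0 : 0 ≤ C := by positivity
  have hpsi : psi γ ρ ε = C * Real.exp ((γ - 1) * γ * ρ) := by
    have : Real.exp ((γ - 1) * (γ * ρ - ε)) =
        Real.exp (-((γ - 1) * ε)) * Real.exp ((γ - 1) * γ * ρ) := by
      rw [← Real.exp_add]; congr 1; ring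
    rw [psi, hC, this]; ring
  have hfin : ∀ᵐ y ∂Q, f y < ∞ := by
    refine ae_lt_top hf ?_
    have : ∫⁻ y, f y ∂Q = P Set.univ := by
      rw [hPQ, withDensity_apply _ MeasurableSet.univ, Measure.restrict_univ]
    rw [this]
    exact measure_ne_top _ _
  have hpt : ∀ᵐ y ∂Q, f y ≤ ENNReal.ofReal (Real.exp ε) + ENNReal.ofReal C * f y ^ γ := by
    filter_upwards [hfin] with y hy
    lift f y to NNReal using hy.ne with x
    have := le_exp_add_mul_rpow hγ ε x.coe_nonneg
    rw [← ENNReal.ofReal_coe_nnreal, ENNReal.ofReal_rpow_of_nonneg x.coe_nonneg (by linarith),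
      ← ENNReal.ofReal_mul hC0, ← ENNReal.ofReal_add (Real.exp_nonneg _) (by positivity)]
    exact ENNReal.ofReal_le_ofReal this
  have hmain : P E ≤ ENNReal.ofReal (Real.exp ε) * Q E + ENNReal.ofReal (psi γ ρ ε) := by
    calc P E = ∫⁻ y in E, f y ∂Q := by rw [hPQ, withDensity_apply _ hE]
      _ ≤ ∫⁻ y in E, (ENNReal.ofReal (Real.exp ε) + ENNReal.ofReal C * f y ^ γ) ∂Q :=
          lintegral_mono_ae (ae_restrict_of_ae hpt)
      _ = ENNReal.ofReal (Real.exp ε) * Q E + ENNReal.ofReal C * ∫⁻ y in E, f y ^ γ ∂Q := by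
          rw [lintegral_add_left measurable_const, lintegral_const, Measure.restrict_apply_univ,
            lintegral_const_mul _ (hf.pow_const _)]
      _ ≤ ENNReal.ofReal (Real.exp ε) * Q E + ENNReal.ofReal C *
          ENNReal.ofReal (Real.exp ((γ - 1) * γ * ρ)) := by
          have h1 := hb (γ - 1) hγ0.le
          rw [sub_add_cancel] at h1
          gcongr
          exact (setLIntegral_le_lintegral _ _).trans h1
      _ = _ := by rw [hpsi, ENNReal.ofReal_mul hC0]
  have hpsi0 : 0 ≤ psi γ ρ ε := by rw [hpsi]; positivity
  have hfin' : ENNReal.ofReal (Real.exp ε) * Q E + ENNReal.ofReal (psi γ ρ ε) ≠ ∞ :=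
    ENNReal.add_ne_top.2 ⟨ENNReal.mul_ne_top ENNReal.ofReal_ne_top (measure_ne_top _ _),
      ENNReal.ofReal_ne_top⟩
  have := ENNReal.toReal_mono hfin' hmain
  rwa [ENNReal.toReal_add (ENNReal.mul_ne_top ENNReal.ofReal_ne_top (measure_ne_top _ _))
    ENNReal.ofReal_ne_top, ENNReal.toReal_mul, ENNReal.toReal_ofReal (Real.exp_nonneg _),
    ENNReal.toReal_ofReal hpsi0] at this

end RenyiBound

end GrowingADA

/-! ### Gaussian answers and the sensitivity of statistical queries. -/

namespace GrowingADA

open scoped ENNReal NNReal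

/-- The likelihood ratio of the normal laws with means `m`, `m'` and common variance `v`. -/
noncomputable def gaussianRatio (m m' v r : ℝ) : ℝ :=
  Real.exp ((m - m') * (2 * r - m - m') / (2 * v))

theorem gaussianReal_eq_withDensity_gaussianRatio (m m' : ℝ) {v : ℝ≥0} (hv : v ≠ 0) :
    gaussianReal m v =
      (gaussianReal m' v).withDensity fun r => ENNReal.ofReal (gaussianRatio m m' v r) := by
  have hm : Measurable fun r => ENNReal.ofReal (gaussianRatio m m' v r) := by
    unfold gaussianRatio; fun_prop
  have hv' : (v : ℝ) ≠ 0 := by exact_mod_cast hv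
  rw [gaussianReal_of_var_ne_zero _ hv, gaussianReal_of_var_ne_zero _ hv,
    ← withDensity_mul _ (measurable_gaussianPDF _ _) hm]
  congr 1
  ext r
  rw [Pi.mul_apply, gaussianPDF, gaussianPDF, ← ENNReal.ofReal_mul (gaussianPDFReal_nonneg _ _ _),
    gaussianPDFReal, gaussianPDFReal, gaussianRatio, mul_assoc (√_)⁻¹, ← Real.exp_add]
  congr 3
  field_simp
  ring

/-- A power of the ratio is the exponential of an affine function of `r`, so the Gaussian moment
generating function evaluates the integral exactly. -/
theorem lintegral_gaussianRatio_rpow (m m' : ℝ) {v : ℝ≥0} (hv : v ≠ 0) (s : ℝ) (hs : 0 ≤ s) :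
    ∫⁻ r, ENNReal.ofReal (gaussianRatio m m' v r) ^ (s + 1) ∂(gaussianReal m' v) =
      ENNReal.ofReal (Real.exp (s * (s + 1) * ((m - m') ^ 2 / (2 * v)))) := by
  have hv' : (v : ℝ) ≠ 0 := by exact_mod_cast hv
  set c : ℝ := (s + 1) * (m - m') / v with hc
  set b : ℝ := Real.exp (-((s + 1) * (m - m') * (m + m') / (2 * v))) with hb
  have e : ∀ r, ENNReal.ofReal (gaussianRatio m m' v r) ^ (s + 1) =
      ENNReal.ofReal (b * Real.exp (c * r)) := by
    intro r
    rw [gaussianRatio, ENNReal.ofReal_rpow_of_nonneg (Real.exp_nonneg _) (by linarith),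
      ← Real.exp_mul, hb, hc, ← Real.exp_add]
    congr 2
    field_simp
    ring
  have hmgf : ∫ r, Real.exp (c * r) ∂(gaussianReal m' v) = Real.exp (m' * c + v * c ^ 2 / 2) :=
    mgf_gaussianReal (X := id) (by simp) c
  simp_rw [e]
  rw [← ofReal_integral_eq_lintegral_ofReal ((integrable_exp_mul_gaussianReal c).const_mul b)
    (Filter.Eventually.of_forall fun r => by positivity), integral_const_mul, hmgf, hb, hc,
    ← Real.exp_add]
  congr 2
  field_simp
  ring

section Mechanism

variable {X : Type*}

theorem gaussianMechanism_apply (σ : ℕ → ℝ) (t : ℕ) (s : Fin t → X) (q : Query X) :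
    gaussianMechanism σ t s q = gaussianReal (q.eval s) (Real.toNNReal (σ t ^ 2)) := by
  change (gaussianReal 0 (Real.toNNReal (σ t ^ 2))).map (fun z => q.eval s + z) = _
  rw [gaussianReal_map_const_add, zero_add]

instance (σ : ℕ → ℝ) (t : ℕ) (s : Fin t → X) : IsMarkovKernel (gaussianMechanism σ t s) :=
  ⟨fun q => by rw [gaussianMechanism_apply]; infer_instance⟩

/-- `M` responds with a measurable function of the response of the Gaussian mechanism. -/
def IsPostprocessedGaussian (σ : ℕ → ℝ) (c : ℝ → ℝ) (M : Mechanism X) : Prop :=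
  Measurable c ∧ ∀ t s, M t s = (gaussianMechanism σ t s).map c

/-- Replacing one of the points `x_1, …, x_t` changes the value of a statistical query by at most
`1 / t`; replacing a later one does not change it. -/
theorem sq_eval_snapshot_sub_le {n : ℕ} {i : Idx n} {x x' : Dataset n X} (h : Neighbor i x x')
    (t : Idx n) (q : Query X) :
    (q.eval (snapshot x t) - q.eval (snapshot x' t)) ^ 2 ≤
      (if (i : ℕ) ≤ t then 1 else 0) / (t : ℝ) ^ 2 := by
  have hi := Finset.mem_Icc.1 i.2
  have ht := Finset.mem_Icc.1 t.2
  have hsub : q.eval (snapshot x t) - q.eval (snapshot x' t) =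
      (∑ j, ((q (snapshot x t j) : ℝ) - q (snapshot x' t j))) / t.1 := by
    rw [Query.eval, Query.eval, ← sub_div, Finset.sum_sub_distrib]
  have hne : ∀ j : Fin t.1, j.1 + 1 ≠ i.1 → snapshot x t j = snapshot x' t j := by
    intro j hj
    refine h _ fun he => hj ?_
    exact congrArg Subtype.val he
  rw [hsub, div_pow]
  gcongr
  split_ifs with hit
  -- Snapshots are indexed from 0: the data point `i` is entry `i - 1`.
  · let j₀ : Fin t.1 := ⟨i.1 - 1, by omega⟩
    rw [Finset.sum_eq_single j₀]
    · rw [sq_le_one_iff_abs_le_one, abs_le]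
      have h1 := (q (snapshot x t j₀)).2
      have h2 := (q (snapshot x' t j₀)).2
      constructor <;> linarith [h1.1, h1.2, h2.1, h2.2]
    · intro j _ hj
      rw [hne j fun he => hj (Fin.ext (by simp only [j₀]; omega)), sub_self]
    · simp
  · rw [Finset.sum_eq_zero]
    · simp
    · intro j _
      rw [hne j (by omega), sub_self]

end Mechanism

/-! ### Induction along the interaction. -/

section Interaction

variable {n : ℕ} {X : Type*} {σ : ℕ → ℝ} {c : ℝ → ℝ} {M : Mechanism X} {A : Analyst n X}

/-- Moves `c` and the bookkeeping into one deterministic map, so that only the analyst and the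
unclipped Gaussian kernel remain to be composed. -/
theorem bind_queryStep [IsMarkovKernel A] (hM : IsPostprocessedGaussian σ c M) (x : Dataset n X)
    (t : Idx n) (μ : Measure (Transcript n X)) [SFinite μ] :
    μ.bind (queryStep A M x t) =
      ((μ ⊗ₘ A) ⊗ₘ (gaussianMechanism σ t (snapshot x t)).prodMkLeft (Transcript n X)).map
        fun p => Transcript.record t (p.1.1, (p.1.2, c p.2)) := by
  have hmk : IsMarkovKernel (M t (snapshot x t)) := by
    rw [hM.2]; exact Kernel.IsMarkovKernel.map _ hM.1
  have hT : Measurable fun p : (Transcript n X × Query X) × ℝ =>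
      Transcript.record t (p.1.1, (p.1.2, c p.2)) :=
    (measurable_record t).comp ((measurable_fst.comp measurable_fst).prodMk
      ((measurable_snd.comp measurable_fst).prodMk (hM.1.comp measurable_snd)))
  refine Measure.ext_of_lintegral _ fun u hu => ?_
  have hur : Measurable fun p : Transcript n X × (Query X × ℝ) => u (Transcript.record t p) :=
    hu.comp (measurable_record t)
  rw [Measure.lintegral_bind (Kernel.measurable _).aemeasurable hu.aemeasurable,
    lintegral_map hu hT]
  refine Eq.trans ?_ (Measure.lintegral_compProd (hu.comp hT)).symm
  rw [Measure.lintegral_compProd (hu.comp hT).lintegral_kernel_prod_right']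
  refine lintegral_congr fun π => ?_
  rw [queryStep, Kernel.lintegral_map _ (measurable_record t) _ hu, Kernel.lintegral_prod _ _ _ hur,
    Kernel.id_apply, lintegral_dirac' _ hur.lintegral_prod_right']
  refine (Kernel.lintegral_compProd _ _ _ (hur.comp measurable_prodMk_left)).trans ?_
  refine lintegral_congr fun q => ?_
  rw [Kernel.prodMkLeft_apply, Kernel.prodMkLeft_apply, hM.2, Kernel.lintegral_map _ hM.1]
  · rfl
  · exact hur.comp (measurable_prodMk_left.comp measurable_prodMk_left)

/-- Relates the laws of the transcripts of two interactions that are run in parallel. -/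
structure Coupled (P Q : Measure (Transcript n X)) (ρ : ℝ) : Prop where
  left : IsProbabilityMeasure P
  right : IsProbabilityMeasure Q
  bound : RenyiBound P Q ρ

/-- The zCDP parameter that one query in round `t` costs the data point `i`. -/
noncomputable def queryCost (σ : ℕ → ℝ) (i t : ℕ) : ℝ :=
  (if i ≤ t then 1 else 0) / (2 * σ t ^ 2 * (t : ℝ) ^ 2)

theorem Coupled.bind_queryStep [IsMarkovKernel A] (hM : IsPostprocessedGaussian σ c M)
    {i : Idx n} {x x' : Dataset n X} (h : Neighbor i x x') {t : Idx n} (hσ : 0 < σ t)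
    {P P' : Measure (Transcript n X)} {ρ : ℝ} (hP : Coupled P P' ρ) :
    Coupled (P.bind (queryStep A M x t)) (P'.bind (queryStep A M x' t))
      (ρ + queryCost σ i t) := by
  have := hP.left
  have := hP.right
  set v : ℝ≥0 := Real.toNNReal (σ t ^ 2) with hv
  have hvr : (v : ℝ) = σ t ^ 2 := Real.coe_toNNReal _ (by positivity)
  have hv0 : v ≠ 0 := by
    rw [hv]; simpa using hσ.ne'
  have hT : Measurable fun p : (Transcript n X × Query X) × ℝ =>
      Transcript.record t (p.1.1, (p.1.2, c p.2)) :=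
    (measurable_record t).comp ((measurable_fst.comp measurable_fst).prodMk
      ((measurable_snd.comp measurable_fst).prodMk (hM.1.comp measurable_snd)))
  rw [GrowingADA.bind_queryStep hM, GrowingADA.bind_queryStep hM]
  refine ⟨Measure.isProbabilityMeasure_map hT.aemeasurable,
    Measure.isProbabilityMeasure_map hT.aemeasurable, RenyiBound.map ?_ hT⟩
  -- Given the transcript, the query has the same law in both runs: density 1, cost 0.
  have hA : RenyiBound (P ⊗ₘ A) (P' ⊗ₘ A) ρ := by
    simpa using hP.bound.compProd (κ := A) (η := A) (g := 1) (ρ' := 0) measurable_one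
      (fun y => (withDensity_one).symm) (fun y s _ => by simp)
  refine hA.compProd (g := fun p => ENNReal.ofReal (gaussianRatio (p.1.2.eval (snapshot x t))
    (p.1.2.eval (snapshot x' t)) v p.2)) ?_ ?_ ?_
  · have h1 : Measurable fun p : (Transcript n X × Query X) × ℝ => p.1.2.eval (snapshot x t) :=
      (measurable_eval _).comp (measurable_snd.comp measurable_fst)
    have h2 : Measurable fun p : (Transcript n X × Query X) × ℝ => p.1.2.eval (snapshot x' t) :=
      (measurable_eval _).comp (measurable_snd.comp measurable_fst)
    unfold gaussianRatio
    fun_prop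
  · rintro ⟨π, q⟩
    rw [Kernel.prodMkLeft_apply, Kernel.prodMkLeft_apply, gaussianMechanism_apply,
      gaussianMechanism_apply]
    exact gaussianReal_eq_withDensity_gaussianRatio _ _ hv0
  · rintro ⟨π, q⟩ s hs
    rw [Kernel.prodMkLeft_apply, gaussianMechanism_apply]
    refine (lintegral_gaussianRatio_rpow (q.eval (snapshot x t)) (q.eval (snapshot x' t)) hv0 s
      hs).le.trans ?_
    refine ENNReal.ofReal_le_ofReal (Real.exp_le_exp.2 (mul_le_mul_of_nonneg_left ?_
      (by positivity)))
    have := sq_eval_snapshot_sub_le h t q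
    rw [hvr, queryCost]
    calc _ ≤ ((if (i : ℕ) ≤ t then 1 else 0) / (t : ℝ) ^ 2) / (2 * σ t ^ 2) := by gcongr
      _ = _ := by rw [div_div, mul_comm ((t : ℝ) ^ 2)]

theorem Coupled.iterate_queryStep [IsMarkovKernel A] (hM : IsPostprocessedGaussian σ c M)
    {i : Idx n} {x x' : Dataset n X} (h : Neighbor i x x') {t : Idx n} (hσ : 0 < σ t) (m : ℕ)
    {P P' : Measure (Transcript n X)} {ρ : ℝ} (hP : Coupled P P' ρ) :
    Coupled ((fun ν : Measure (Transcript n X) => ν.bind (queryStep A M x t))^[m] P)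
      ((fun ν : Measure (Transcript n X) => ν.bind (queryStep A M x' t))^[m] P')
      (ρ + m * queryCost σ i t) := by
  induction m with
  | zero => simpa using hP
  | succ m ih =>
    rw [Function.iterate_succ_apply', Function.iterate_succ_apply']
    convert ih.bind_queryStep (A := A) hM h hσ using 1
    push_cast
    ring

theorem Coupled.foldl_queryStep [IsMarkovKernel A] (hM : IsPostprocessedGaussian σ c M)
    {i : Idx n} {x x' : Dataset n X} (h : Neighbor i x x') (k : ℕ → ℕ) (l : List (Idx n))
    (hσ : ∀ t ∈ l, 0 < σ t) {P P' : Measure (Transcript n X)} {ρ : ℝ} (hP : Coupled P P' ρ) :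
    Coupled
      (l.foldl (fun μ t =>
        (fun ν : Measure (Transcript n X) => ν.bind (queryStep A M x t))^[k t] μ) P)
      (l.foldl (fun μ t =>
        (fun ν : Measure (Transcript n X) => ν.bind (queryStep A M x' t))^[k t] μ) P')
      (ρ + (l.map fun t : Idx n => (k t : ℝ) * queryCost σ i t).sum) := by
  induction l generalizing P P' ρ with
  | nil => simpa using hP
  | cons t l ih =>
    rw [List.foldl_cons, List.foldl_cons, List.map_cons, List.sum_cons, ← add_assoc]
    exact ih (fun t ht => hσ t (List.mem_cons_of_mem _ ht))
      (hP.iterate_queryStep hM h (hσ t List.mem_cons_self) (k t))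

theorem sum_rounds_queryCost {n₀ : ℕ} (hn₀ : 1 ≤ n₀) (k : ℕ → ℕ) (σ : ℕ → ℝ) (i : Idx n) :
    (((rounds n n₀).sort (· ≤ ·)).map fun t : Idx n => (k t : ℝ) * queryCost σ i t).sum =
      rho n n₀ k σ i := by
  have h1 : (((rounds n n₀).sort (· ≤ ·)).map fun t : Idx n => (k t : ℝ) * queryCost σ i t).sum =
      ∑ t ∈ rounds n n₀, (k t : ℝ) * queryCost σ i t := by
    rw [← List.sum_toFinset _ (Finset.sort_nodup _ _), Finset.sort_toFinset]
  rw [h1, rho]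
  refine Finset.sum_bij (fun t _ => t.1) ?_ ?_ ?_ ?_
  · intro t ht
    have := (Finset.mem_Icc.1 t.2).2
    simp only [rounds, Finset.mem_filter, Finset.mem_univ, true_and] at ht
    exact Finset.mem_Icc.2 ⟨ht, this⟩
  · intro a _ b _ hab
    exact Subtype.ext hab
  · intro τ hτ
    have hτ := Finset.mem_Icc.1 hτ
    exact ⟨⟨τ, Finset.mem_Icc.2 ⟨hn₀.trans hτ.1, hτ.2⟩⟩, by simp [rounds, hτ.1], rfl⟩
  · intro t _
    rw [queryCost, mul_div_assoc]

theorem coupled_interact [IsMarkovKernel A] (hM : IsPostprocessedGaussian σ c M) {n₀ : ℕ}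
    (hn₀ : 1 ≤ n₀) (hσ : ∀ τ ∈ Finset.Icc n₀ n, 0 < σ τ) (k : ℕ → ℕ) {i : Idx n}
    {x x' : Dataset n X} (h : Neighbor i x x') :
    Coupled (interact n₀ k A M x) (interact n₀ k A M x') (rho n n₀ k σ i) := by
  have h0 : Coupled (Measure.dirac (Transcript.empty n X)) (Measure.dirac (Transcript.empty n X))
      0 := ⟨inferInstance, inferInstance, RenyiBound.refl _⟩
  have := h0.foldl_queryStep (A := A) hM h k ((rounds n n₀).sort (· ≤ ·)) fun t ht => by
    refine hσ _ (Finset.mem_Icc.2 ⟨?_, (Finset.mem_Icc.1 t.2).2⟩)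
    simpa [rounds] using ht
  rwa [sum_rounds_queryCost hn₀, zero_add] at this

end Interaction

end GrowingADA

/-! ### The optimal order. -/

namespace GrowingADA

open Set Filter Topology

/-- The logarithm of `ψ(·, ρ, ε)` on `(1, ∞)`. -/
noncomputable def logPsi (ρ ε γ : ℝ) : ℝ :=
  (γ - 1) * (γ * ρ - ε) + (γ - 1) * Real.log (γ - 1) - γ * Real.log γ

theorem psi_eq_exp_logPsi {γ : ℝ} (hγ : 1 < γ) (ρ ε : ℝ) : psi γ ρ ε = Real.exp (logPsi ρ ε γ) := by
  have h1 : 0 < γ - 1 := by linarith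
  have h0 : 0 < γ := by linarith
  have e : 1 - γ⁻¹ = (γ - 1) / γ := by field_simp
  have e2 : Real.exp (logPsi ρ ε γ) = Real.exp ((γ - 1) * (γ * ρ - ε)) *
      Real.exp (Real.log ((γ - 1) / γ) * γ) / Real.exp (Real.log (γ - 1)) := by
    rw [← Real.exp_add, ← Real.exp_sub, logPsi, Real.log_div h1.ne' h0.ne']
    congr 1
    ring
  rw [psi, e, Real.rpow_def_of_pos (by positivity), e2, Real.exp_log h1]

theorem psi_nonneg {γ : ℝ} (hγ : 1 < γ) (ρ ε : ℝ) : 0 ≤ psi γ ρ ε := by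
  rw [psi_eq_exp_logPsi hγ]
  positivity

theorem psi_mono {γ ρ ρ' : ℝ} (hγ : 1 < γ) (h : ρ ≤ ρ') (ε : ℝ) : psi γ ρ ε ≤ psi γ ρ' ε := by
  rw [psi_eq_exp_logPsi hγ, psi_eq_exp_logPsi hγ, Real.exp_le_exp, logPsi, logPsi]
  have h1 : 0 ≤ γ - 1 := by linarith
  gcongr

/-- Continuity includes `γ = 1`, since `x log x` tends to 0 at 0 and takes the value 0 there; this
gives the limit of `psi` at 1. -/
theorem continuous_logPsi (ρ ε : ℝ) : Continuous (logPsi ρ ε) := by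
  have h1 : Continuous fun γ : ℝ => (γ - 1) * Real.log (γ - 1) :=
    Real.continuous_mul_log.comp (continuous_id.sub continuous_const)
  have h2 : Continuous fun γ : ℝ => γ * Real.log γ := Real.continuous_mul_log
  unfold logPsi
  exact ((by fun_prop : Continuous fun γ : ℝ => (γ - 1) * (γ * ρ - ε)).add h1).sub h2

/-- The optimal value is at most the limit of `ψ(γ, ρ, ε)` as `γ` tends to `1`. -/
theorem IsOptimalOrder.psi_le_one {ρ ε γ : ℝ} (h : IsOptimalOrder ρ ε γ) : psi γ ρ ε ≤ 1 := by
  have hlim : Tendsto (fun γ' => Real.exp (logPsi ρ ε γ')) (𝓝[>] 1) (𝓝 1) := by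
    have := (Real.continuous_exp.comp (continuous_logPsi ρ ε)).tendsto 1
    simp only [Function.comp_def, logPsi, sub_self, zero_mul, Real.log_one, mul_zero,
      add_zero, Real.exp_zero] at this
    exact this.mono_left nhdsWithin_le_nhds
  refine ge_of_tendsto hlim ?_
  filter_upwards [self_mem_nhdsWithin] with γ' hγ'
  rw [← psi_eq_exp_logPsi hγ']
  exact h.2 γ' hγ'

theorem hasDerivAt_logPsi (ρ ε : ℝ) {γ : ℝ} (hγ : 1 < γ) :
    HasDerivAt (logPsi ρ ε) ((2 * γ - 1) * ρ - ε + Real.log (1 - γ⁻¹)) γ := by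
  have h1 : γ - 1 ≠ 0 := by linarith
  have h0 : γ ≠ 0 := by linarith
  have e : 1 - γ⁻¹ = (γ - 1) / γ := by field_simp
  have hs : HasDerivAt (fun γ : ℝ => γ - 1) 1 γ := (hasDerivAt_id γ).sub_const 1
  have ha : HasDerivAt (fun γ : ℝ => γ * ρ - ε) (1 * ρ) γ :=
    ((hasDerivAt_id γ).mul_const ρ).sub_const ε
  have hb : HasDerivAt (fun γ : ℝ => (γ - 1) * Real.log (γ - 1))
      ((Real.log (γ - 1) + 1) * 1) γ :=
    HasDerivAt.comp (h₂ := fun y : ℝ => y * Real.log y) γ (Real.hasDerivAt_mul_log h1) hs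
  refine (((hs.mul ha).add hb).sub (Real.hasDerivAt_mul_log h0)).congr_deriv ?_
  rw [e, Real.log_div h1 h0]
  ring

theorem strictMonoOn_deriv_logPsi {ρ : ℝ} (hρ : 0 < ρ) (ε : ℝ) :
    StrictMonoOn (fun γ : ℝ => (2 * γ - 1) * ρ - ε + Real.log (1 - γ⁻¹)) (Ioi 1) := by
  intro a ha b hb hab
  have ha : 1 < a := ha
  have hinv : b⁻¹ < a⁻¹ := inv_strictAnti₀ (by linarith) hab
  have hpos : 0 < 1 - a⁻¹ := sub_pos.2 (inv_lt_one_of_one_lt₀ ha)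
  have := Real.log_lt_log hpos (by linarith : 1 - a⁻¹ < 1 - b⁻¹)
  have : (2 * a - 1) * ρ < (2 * b - 1) * ρ := by gcongr
  dsimp only
  linarith

/-- The logarithm drives the derivative to `-∞` at 1, the term `2γρ` drives it to `+∞` at infinity,
and the intermediate value theorem applies. -/
theorem exists_deriv_logPsi_eq_zero {ρ : ℝ} (hρ : 0 < ρ) (ε : ℝ) :
    ∃ γ : ℝ, 1 < γ ∧ (2 * γ - 1) * ρ - ε + Real.log (1 - γ⁻¹) = 0 := by
  set d : ℝ → ℝ := fun γ => (2 * γ - 1) * ρ - ε + Real.log (1 - γ⁻¹) with hd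
  have hcont : ContinuousOn d (Ioi 1) := by
    intro γ hγ
    have hγ : 1 < γ := hγ
    have h0 : γ ≠ 0 := by linarith
    have h1 : 1 - γ⁻¹ ≠ 0 := (sub_pos.2 (inv_lt_one_of_one_lt₀ hγ)).ne'
    have : ContinuousAt d γ := by
      refine ContinuousAt.add (by fun_prop) (ContinuousAt.log ?_ h1)
      exact continuousAt_const.sub (continuousAt_inv₀ h0)
    exact this.continuousWithinAt
  have htop : Tendsto d atTop atTop := by
    have h1 : Tendsto (fun γ : ℝ => (2 * γ - 1) * ρ - ε) atTop atTop := by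
      have : Tendsto (fun γ : ℝ => (2 * ρ) * γ + (-ρ - ε)) atTop atTop :=
        tendsto_atTop_add_const_right _ _ (tendsto_id.const_mul_atTop (by linarith))
      refine this.congr fun γ => ?_
      ring
    have h2 : Tendsto (fun γ : ℝ => Real.log (1 - γ⁻¹)) atTop (𝓝 0) := by
      have h3 : Tendsto (fun γ : ℝ => 1 - γ⁻¹) atTop (𝓝 1) := by
        simpa using tendsto_inv_atTop_zero.const_sub (1 : ℝ)
      simpa using h3.log one_ne_zero
    exact h1.atTop_add h2
  have hbot : Tendsto d (𝓝[>] 1) atBot := by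
    have h1 : Tendsto (fun γ : ℝ => (2 * γ - 1) * ρ - ε) (𝓝[>] 1) (𝓝 ((2 * 1 - 1) * ρ - ε)) :=
      ((by fun_prop : Continuous fun γ : ℝ => (2 * γ - 1) * ρ - ε).tendsto 1).mono_left
        nhdsWithin_le_nhds
    have h2 : Tendsto (fun γ : ℝ => 1 - γ⁻¹) (𝓝[>] 1) (𝓝[>] 0) := by
      refine tendsto_nhdsWithin_iff.2 ⟨?_, ?_⟩
      · have : Tendsto (fun γ : ℝ => 1 - γ⁻¹) (𝓝 1) (𝓝 (1 - 1⁻¹)) :=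
          (continuousAt_inv₀ one_ne_zero).tendsto.const_sub 1
        simpa using this.mono_left nhdsWithin_le_nhds
      · filter_upwards [self_mem_nhdsWithin] with γ hγ
        exact sub_pos.2 (inv_lt_one_of_one_lt₀ (mem_Ioi.1 hγ))
    exact h1.add_atBot (Real.tendsto_log_nhdsGT_zero.comp h2)
  obtain ⟨a, ha, ha'⟩ := ((hbot.eventually (eventually_le_atBot 0)).and
    self_mem_nhdsWithin).exists
  obtain ⟨b, hb, hb'⟩ := ((htop.eventually (eventually_ge_atTop 0)).and
    (eventually_gt_atTop 1)).exists
  obtain ⟨γ, hγ, hγ0⟩ := isPreconnected_Ioi.intermediate_value ha' hb' hcont ⟨ha, hb⟩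
  exact ⟨γ, hγ, hγ0⟩

theorem existsUnique_isOptimalOrder {ρ : ℝ} (hρ : 0 < ρ) (ε : ℝ) :
    ∃! γ : ℝ, IsOptimalOrder ρ ε γ := by
  obtain ⟨γ, hγ, hzero⟩ := exists_deriv_logPsi_eq_zero hρ ε
  have hmono := strictMonoOn_deriv_logPsi hρ ε
  have hconv : StrictConvexOn ℝ (Ioi 1) (logPsi ρ ε) := by
    refine StrictMonoOn.strictConvexOn_of_deriv (convex_Ioi 1)
      (continuous_logPsi ρ ε).continuousOn ?_
    rw [interior_Ioi]
    exact hmono.congr fun γ hγ => (hasDerivAt_logPsi ρ ε hγ).deriv.symm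
  have hmin : ∀ γ', 1 < γ' → logPsi ρ ε γ ≤ logPsi ρ ε γ' := by
    have hloc : IsMinOn (logPsi ρ ε) (Ioi 1) γ := by
      refine hconv.convexOn.isMinOn_of_rightDeriv_eq_zero (by rwa [interior_Ioi]) ?_
      rw [((hasDerivAt_logPsi ρ ε hγ).hasDerivWithinAt).derivWithin (uniqueDiffWithinAt_Ioi γ),
        hzero]
    exact fun γ' h => hloc h
  have hopt : ∀ γ', IsOptimalOrder ρ ε γ' ↔ γ' ∈ Ioi (1 : ℝ) ∧ IsMinOn (logPsi ρ ε) (Ioi 1) γ' := by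
    intro γ'
    refine and_congr_right fun h' => ?_
    refine forall₂_congr fun a ha => ?_
    change _ ↔ logPsi ρ ε γ' ≤ logPsi ρ ε a
    rw [psi_eq_exp_logPsi h', psi_eq_exp_logPsi ha, Real.exp_le_exp]
  refine ⟨γ, (hopt γ).2 ⟨hγ, fun a ha => hmin a ha⟩, fun γ' h' => ?_⟩
  have h' := (hopt γ').1 h'
  exact hconv.eq_of_isMinOn h'.2 (fun a ha => hmin a ha) h'.1 hγ

end GrowingADA

/-! ### Assembly. -/

namespace GrowingADA

theorem rho_nonneg (n n₀ : ℕ) (k : ℕ → ℕ) (σ : ℕ → ℝ) (t : Idx n) : 0 ≤ rho n n₀ k σ t := by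
  refine Finset.sum_nonneg fun τ _ => ?_
  split_ifs <;> positivity

theorem iSup_rho_pos {n n₀ : ℕ} (hn₀ : 1 ≤ n₀) {k : ℕ → ℕ} {σ : ℕ → ℝ}
    (hσ : ∀ τ ∈ Finset.Icc n₀ n, 0 < σ τ) (hk : ∃ τ ∈ Finset.Icc n₀ n, 0 < k τ) :
    0 < ⨆ t : Idx n, rho n n₀ k σ t := by
  obtain ⟨τ, hτ, hkτ⟩ := hk
  have hτ' := Finset.mem_Icc.1 hτ
  have hστ := hσ τ hτ
  have hτ0 : 0 < τ := by omega
  let t : Idx n := ⟨τ, Finset.mem_Icc.2 ⟨hτ0, hτ'.2⟩⟩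
  refine lt_of_lt_of_le ?_ (le_ciSup (Set.finite_range _).bddAbove t)
  refine Finset.sum_pos' (fun τ' _ => ?_) ⟨τ, hτ, ?_⟩
  · split_ifs <;> positivity
  · rw [if_pos le_rfl]
    positivity

theorem exists_isPostprocessedGaussian {X : Type*} {σ : ℕ → ℝ} {M : Mechanism X}
    (hM : M = gaussianMechanism σ ∨ M = clippedGaussianMechanism σ) :
    ∃ c, IsPostprocessedGaussian σ c M := by
  rcases hM with rfl | rfl
  · exact ⟨id, measurable_id, fun t s => (Kernel.map_id _).symm⟩
  · exact ⟨clamp, measurable_clamp, fun t s => rfl⟩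

end GrowingADA

theorem mainTheorem8 {X : Type*} [Finite X] (n n₀ : ℕ) (hn₀ : 1 ≤ n₀) (hn : n₀ ≤ n)
    (σ : ℕ → ℝ) (hσ : ∀ τ ∈ Finset.Icc n₀ n, 0 < σ τ) (k : ℕ → ℕ) (M : Mechanism X)
    (hM : M = gaussianMechanism σ ∨ M = clippedGaussianMechanism σ) :
    InteractionZCDP n₀ k M (rho n n₀ k σ) ∧
    ∀ ε : ℝ, 0 < ε →
      ((∃ τ ∈ Finset.Icc n₀ n, 0 < k τ) →
        ∃! γ : ℝ, IsOptimalOrder (⨆ t : Idx n, rho n n₀ k σ t) ε γ) ∧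
      ∀ γ : ℝ, IsOptimalOrder (⨆ t : Idx n, rho n n₀ k σ t) ε γ →
        InteractionDP n₀ k M ε (fun t : Idx n => psi γ (rho n n₀ k σ t) ε) := by
  obtain ⟨c, hc⟩ := exists_isPostprocessedGaussian hM
  refine ⟨fun A _ => ⟨rho_nonneg n n₀ k σ, fun i x x' h => ?_⟩, fun ε hε =>
    ⟨fun hk => existsUnique_isOptimalOrder (iSup_rho_pos hn₀ hσ hk) ε, fun γ hγ A _ =>
      ⟨hε.le, fun i => ⟨psi_nonneg hγ.1 _ _, ?_⟩, fun i x x' h E hE => ?_⟩⟩⟩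
  · have hC := coupled_interact (A := A) hc hn₀ hσ k h
    have := hC.left
    have := hC.right
    exact ⟨hC.bound.absolutelyContinuous, fun s hs => hC.bound.lintegral_privLoss_le hs⟩
  -- `γ` is optimal only for the largest parameter; smaller ones give a smaller `psi` at the same
  -- `γ`.
  · exact (psi_mono hγ.1 (le_ciSup (Set.finite_range _).bddAbove i) ε).trans hγ.psi_le_one
  · have hC := coupled_interact (A := A) hc hn₀ hσ k h
    have := hC.left
    have := hC.right
    exact hC.bound.real_le ε hγ.1 hE
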